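/- Let $(R,\mathfrak m)$ be a Gorenstein local ring of dimension $d\ge 2$, let $s\ge 2$ be an integer, and let $J=(z_1,\dots,z_d)$ be an ideal generated by a regular sequence $z_1,\dots,z_d$ contained in $\mathfrak m^s$. For $k=0,1,\dots,s$ put $I_k=J:\mathfrak m^k$ (so $I_0=J$), and assume that $\mathfrak m^k:\mathfrak m=\mathfrak m^{k-1}$ for all $k$ with $3\le k\le s$. For $k=1,\dots,s$ let $n_k=\lambda(\mathfrak m^{k-1}/\mathfrak m^k)$, where $\lambda$ denotes length; $n_k$ is finite. Then for every $k=1,\dots,s$ one has $J\subseteq I_{k-1}\subseteq I_k$ and: (a) $I_k/I_{k-1}$ is annihilated by $\mathfrak m$, and it is an $R/\mathfrak m$-vector space of dimension $n_k$. Hence there are $b_1,\dots,b_{n_k}\in I_k$ with $I_k=(I_{k-1},b_1,\dots,b_{n_k})$ whose residue classes are minimal generators of $I_k/I_{k-1}$. (b) For every such choice of $b_1,\dots,b_{n_k}$ as in (a), $I_k=(J,b_1,\dots,b_{n_k})$, and the residue classes of $b_1,\dots,b_{n_k}$ are minimal generators of $I_k/J$. (c) $z_1,\dots,z_d$ is part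 of a minimal system of generators of $I_k$ if and only if $\mu(I_k)=d+n_k$, where $\mu(I_k)$ denotes the minimal number of generators of $I_k$. (d) $I_{k-1}=\mathfrak m I_k+J$. (Here elements $x_1,\dots,x_r$ are minimal generators of a module if they generate it and no $r-1$ of them do.) -/

import Mathlib

/-- A Gorenstein local ring: a Noetherian local ring of finite injective dimension as a module
over itself. -/
class IsGorensteinLocalRing (R : Type*) [CommRing R] : Prop
    extends IsLocalRing R, IsNoetherianRing R where
  exists_injectiveDimensionLT :
    ∃ n : ℕ, CategoryTheory.HasInjectiveDimensionLT (ModuleCat.of R R) n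

/-- The family `x` is a minimal system of generators of `N`: it generates `N`, and it stops doing
so when any one member is left out. -/
def IsMinimalGenerators {R M ι : Type*} [CommRing R] [AddCommGroup M] [Module R M]
    (N : Submodule R M) (x : ι → M) : Prop :=
  Submodule.span R (Set.range x) = N ∧ ∀ i, Submodule.span R (x '' {i}ᶜ) ≠ N

/-- The iterated link `I_k = J : 𝔪 ^ k`; in particular `I_0 = J`. -/
def iteratedLink {R : Type*} [CommRing R] [IsLocalRing R] (J : Ideal R) (k : ℕ) : Ideal R :=
  J.colon ((IsLocalRing.maximalIdeal R ^ k : Ideal R) : Set R)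

/-- The `R`-module `I / L` for ideals `L ⊆ I`. -/
abbrev idealQuotient {R : Type*} [CommRing R] (I L : Ideal R) : Type _ :=
  I ⧸ Submodule.submoduleOf L I

/-- The residue class in `I / L` of an element of `I`. -/
abbrev idealQuotientMk {R : Type*} [CommRing R] (I L : Ideal R) (x : I) : idealQuotient I L :=
  Submodule.Quotient.mk x

/-! ### Ext over a local ring: regular sequences and vanishing on finite length modules. -/

section Homological

open CategoryTheory CategoryTheory.Abelian RingTheory.Sequence IsLocalRing Pointwise

universe u

variable {R : Type u} [CommRing R]

/-! Everything rests on duality in the Artinian ring `R / J`: `J : (J : I) = I` for ideals `I ⊇ J`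
(`colon_colon_of_isGorensteinLocalRing`). So `I ↦ J : I` reverses the lattice of ideals above `J`
and preserves lengths of intervals, and `I_k / I_{k-1}` is as long as `𝔪^{k-1} / 𝔪^k`. It also gives
(d): `J : (𝔪 I_k + J) = (J : I_k) : 𝔪 = 𝔪^k : 𝔪 = 𝔪^{k-1}`, and one more colon yields `I_{k-1}`.
Then (b) is Nakayama, and (c) counts generators.

The duality comes from finite injective dimension. As `R / J` has finite length and projective
dimension `d`, `Ext^i(-, R)` vanishes on finite length modules for `i > d`. Hence `Ext^d(-, R)`
turns inclusions of such modules into surjections. Dimension shifting along `z` carries this to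
`Hom(-, R / J)` on modules killed by `J`, so maps into `R / J` extend. -/

theorem comp_smulShortComplex_f_eq_zero {M N : ModuleCat.{u} R} {x : R}
    (hx : x ∈ Module.annihilator R N) {i : ℕ} (e : Ext N M i) :
    e.comp (Ext.mk₀ (M.smulShortComplex x).f) (add_zero i) = 0 := by
  have hx0 : x • 𝟙 N = 0 := by
    simp [← ModuleCat.lsmul_eq_smul_id, Module.mem_annihilator_iff_lsmul_eq_zero.mp hx]
  have h1 : x • e = 0 := by
    rw [← Ext.mk₀_id_comp (x • e), Ext.comp_smul, ← Ext.smul_comp, ← Ext.mk₀_smul, hx0,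
      Ext.mk₀_zero, Ext.zero_comp]
  exact (Ext.smul_eq_comp_mk₀ e x).symm.trans h1

/-- `Ext^i(N, M)` vanishes for `i` below the length of an `M`-regular sequence killing `N`. -/
theorem subsingleton_ext_of_isWeaklyRegular {N : ModuleCat.{u} R} (rs : List R)
    (hN : ∀ r ∈ rs, r ∈ Module.annihilator R N) (M : ModuleCat.{u} R)
    (hM : IsWeaklyRegular M rs) (i : ℕ) (hi : i < rs.length) : Subsingleton (Ext N M i) := by
  induction rs generalizing M i with
  | nil => simp at hi
  | cons x rs ih =>
    rw [isWeaklyRegular_cons_iff] at hM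
    simp only [List.mem_cons, forall_eq_or_imp] at hN
    have hS := hM.1.smulShortComplex_shortExact
    have inj (e : Ext N M i) : e = 0 := by
      have h0 := comp_smulShortComplex_f_eq_zero hN.1 e
      cases i with
      | zero =>
        have := hS.mono_f
        refine Ext.postcomp_mk₀_injective_of_mono N (M.smulShortComplex x).f ?_
        exact h0.trans (map_zero _).symm
      | succ i =>
        -- Multiplication by `x` kills `e`, so `e` comes from `Ext^i(N, M / xM)`, which is zero by
        -- induction.
        obtain ⟨y, rfl⟩ := Ext.covariant_sequence_exact₁ N hS e h0 rfl
        have : Subsingleton (Ext N (M.smulShortComplex x).X₃ i) :=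
          ih hN.2 (ModuleCat.of R (QuotSMulTop x M)) hM.2 i (by simpa using hi)
        rw [Subsingleton.elim y 0, Ext.zero_comp]
        rfl
    exact ⟨fun a b => (inj a).trans (inj b).symm⟩

/-- If classes in `Ext^n(N, M)` extend along `f : N ⟶ N'`, where `n` is the length of an
`M`-regular sequence `rs` killing `N` and `N'`, then so do morphisms to `M / (rs) M`. -/
theorem exists_extension_to_quotient (rs : List R) (M : ModuleCat.{u} R)
    (hM : IsWeaklyRegular M rs) {N N' : ModuleCat.{u} R} (f : N ⟶ N')
    (hN : ∀ r ∈ rs, r ∈ Module.annihilator R N) (hN' : ∀ r ∈ rs, r ∈ Module.annihilator R N')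
    (H : ∀ α : Ext N M rs.length,
      ∃ β : Ext N' M rs.length, (Ext.mk₀ f).comp β (zero_add _) = α)
    (φ : N →ₗ[R] M ⧸ (Ideal.ofList rs • ⊤ : Submodule R M)) :
    ∃ ψ : N' →ₗ[R] M ⧸ (Ideal.ofList rs • ⊤ : Submodule R M), ψ ∘ₗ f.hom = φ := by
  induction rs generalizing M with
  | nil =>
    have e : (M ⧸ (Ideal.ofList ([] : List R) • ⊤ : Submodule R M)) ≃ₗ[R] M :=
      Submodule.quotEquivOfEqBot _ (by simp)
    obtain ⟨β, hβ⟩ := H (Ext.mk₀ (ModuleCat.ofHom (e.toLinearMap ∘ₗ φ)))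
    obtain ⟨ψ, rfl⟩ := (Ext.mk₀_bijective N' M).2 β
    rw [Ext.mk₀_comp_mk₀] at hβ
    have h := congrArg ModuleCat.Hom.hom ((Ext.mk₀_bijective N M).1 hβ)
    refine ⟨e.symm.toLinearMap ∘ₗ ψ.hom, LinearMap.ext fun n => ?_⟩
    have h' := LinearMap.congr_fun h n
    simp only [ModuleCat.hom_comp, LinearMap.comp_apply, ModuleCat.hom_ofHom] at h'
    simp [h']
  | cons x rs ih =>
    have hN0 := hN
    rw [isWeaklyRegular_cons_iff] at hM
    simp only [List.mem_cons, forall_eq_or_imp] at hN hN'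
    have hS := hM.1.smulShortComplex_shortExact
    let e := Submodule.quotOfListConsSMulTopEquivQuotSMulTopInner M x rs
    have hlift (α : Ext N (M.smulShortComplex x).X₃ rs.length) :
        ∃ β : Ext N' (M.smulShortComplex x).X₃ rs.length,
          (Ext.mk₀ f).comp β (zero_add _) = α := by
      -- Extend the image of `α` under the connecting map. The extension is killed by `x`, so it
      -- lifts to some `γ`; the connecting map is injective on classes over `N`, so `γ` restricts to
      -- `α`.
      obtain ⟨β, hβ⟩ := H (α.comp hS.extClass rfl)
      obtain ⟨γ, hγ⟩ := Ext.covariant_sequence_exact₁ N' hS β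
        (comp_smulShortComplex_f_eq_zero hN'.1 β) rfl
      refine ⟨γ, sub_eq_zero.mp ?_⟩
      obtain ⟨δ, hδ⟩ := Ext.covariant_sequence_exact₃ N hS
        ((Ext.mk₀ f).comp γ (zero_add _) - α) (n₁ := (x :: rs).length) rfl (by
          rw [sub_eq_add_neg, Ext.add_comp, Ext.neg_comp, ← hβ, ← hγ,
            Ext.comp_assoc _ _ _ (zero_add _) rfl (by simp)]
          exact add_neg_cancel _)
      have : Subsingleton (Ext N (M.smulShortComplex x).X₂ rs.length) :=
        subsingleton_ext_of_isWeaklyRegular (x :: rs) hN0 M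
          ((isWeaklyRegular_cons_iff M x rs).2 hM) _ (by simp)
      rw [← hδ, Subsingleton.elim δ 0, Ext.zero_comp]
    obtain ⟨ψ, hψ⟩ := ih (ModuleCat.of R (QuotSMulTop x M)) hM.2 hN.2 hN'.2 hlift
      (e.toLinearMap ∘ₗ φ)
    refine ⟨e.symm.toLinearMap ∘ₗ ψ, LinearMap.ext fun n => ?_⟩
    have h' := LinearMap.congr_fun hψ n
    simp only [LinearMap.comp_apply] at h'
    simp [h']

/-- Simple modules over a local ring are isomorphic. -/
theorem nonempty_linearEquiv_of_isSimpleModule [IsLocalRing R] (S T : Type*)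
    [AddCommGroup S] [Module R S] [AddCommGroup T] [Module R T]
    [hS : IsSimpleModule R S] [hT : IsSimpleModule R T] : Nonempty (S ≃ₗ[R] T) := by
  obtain ⟨I, hI, ⟨e⟩⟩ := isSimpleModule_iff_quot_maximal.mp hS
  obtain ⟨J, hJ, ⟨e'⟩⟩ := isSimpleModule_iff_quot_maximal.mp hT
  obtain rfl := eq_maximalIdeal hI
  obtain rfl := eq_maximalIdeal hJ
  exact ⟨e.trans e'.symm⟩

theorem exists_isSimpleModule_submodule (M : Type*) [AddCommGroup M] [Module R M]
    [Nontrivial M] [IsArtinian R M] : ∃ S : Submodule R M, IsSimpleModule R S := by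
  simpa only [isSimpleModule_iff_isAtom] using IsAtomic.exists_atom (Submodule R M)

theorem shortExact_of_injective {M N : ModuleCat.{u} R} (f : M →ₗ[R] N)
    (hf : Function.Injective f) :
    (ModuleCat.shortComplexOfCompEqZero f (LinearMap.range f).mkQ
      f.exact_map_mkQ_range.linearMap_comp_eq_zero).ShortExact :=
  ModuleCat.shortComplex_shortExact _ f.exact_map_mkQ_range hf (Submodule.mkQ_surjective _)

/-- If `f : M → N` is injective and `Ext^{n+1}(N / M, Y)` vanishes, then classes in `Ext^n(M, Y)`
extend along `f`. -/
theorem exists_ext_extension {M N Y : ModuleCat.{u} R} (f : M →ₗ[R] N)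
    (hf : Function.Injective f) (n : ℕ)
    (h : Subsingleton (Ext (ModuleCat.of R (N ⧸ LinearMap.range f)) Y (n + 1)))
    (α : Ext M Y n) : ∃ β : Ext N Y n, (Ext.mk₀ (ModuleCat.ofHom f)).comp β (zero_add _) = α :=
  Ext.contravariant_sequence_exact₁ (shortExact_of_injective f hf) Y α (add_comm 1 n)
    (@Subsingleton.elim _ h _ _)

theorem subsingleton_ext_of_linearEquiv {M N Y : ModuleCat.{u} R} (e : M ≃ₗ[R] N) (n : ℕ)
    (h : Subsingleton (Ext N Y n)) : Subsingleton (Ext M Y n) := by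
  have key (α : Ext M Y n) : α = 0 := by
    rw [← Ext.mk₀_id_comp α, ← e.toModuleIso.hom_inv_id, ← Ext.mk₀_comp_mk₀_assoc,
      Subsingleton.elim ((Ext.mk₀ e.toModuleIso.inv).comp α (zero_add n)) 0, Ext.comp_zero]
  exact ⟨fun a b => (key a).trans (key b).symm⟩

/-- Over a local ring, the vanishing of `Ext^n(-, Y)` on one simple module implies its vanishing
on all modules of finite length. -/
theorem subsingleton_ext_of_isFiniteLength [IsLocalRing R] (S : ModuleCat.{u} R)
    [IsSimpleModule R S] (Y : ModuleCat.{u} R) (n : ℕ) (h : Subsingleton (Ext S Y n))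
    (M : Type u) [AddCommGroup M] [Module R M] (hM : IsFiniteLength R M) :
    Subsingleton (Ext (ModuleCat.of R M) Y n) := by
  induction hM with
  | of_subsingleton =>
    rename_i M _ _ _
    have key (α : Ext (ModuleCat.of R M) Y n) : α = 0 := by
      rw [← Ext.mk₀_id_comp α, (ModuleCat.isZero_of_subsingleton _).eq_zero_of_src (𝟙 _),
        Ext.mk₀_zero, Ext.zero_comp]
    exact ⟨fun a b => (key a).trans (key b).symm⟩
  | of_simple_quotient hN ih =>
    rename_i M _ _ N _
    obtain ⟨e⟩ := nonempty_linearEquiv_of_isSimpleModule (R := R) (M ⧸ N) S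
    have hQ := subsingleton_ext_of_linearEquiv (M := ModuleCat.of R (M ⧸ N)) (Y := Y) e n h
    have hS : (ModuleCat.shortComplexOfCompEqZero N.subtype N.mkQ
        (LinearMap.exact_subtype_mkQ N).linearMap_comp_eq_zero).ShortExact :=
      ModuleCat.shortComplex_shortExact _ (LinearMap.exact_subtype_mkQ N) N.subtype_injective
        N.mkQ_surjective
    have key (α : Ext (ModuleCat.of R M) Y n) : α = 0 := by
      obtain ⟨β, rfl⟩ := Ext.contravariant_sequence_exact₂ hS Y α (@Subsingleton.elim _ ih _ _)
      rw [@Subsingleton.elim _ hQ β 0, Ext.comp_zero]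
    exact ⟨fun a b => (key a).trans (key b).symm⟩

/-- If `A ≠ 0` has finite length and projective dimension at most `d`, and `Y` has finite injective
dimension, then `Ext^i(-, Y)` vanishes on modules of finite length for `i > d`. -/
theorem subsingleton_ext_of_projectiveDimension_of_injectiveDimension [IsLocalRing R]
    (A Y : ModuleCat.{u} R) [Nontrivial A] (hA : IsFiniteLength R A) (d n : ℕ)
    [HasProjectiveDimensionLT A (d + 1)] [HasInjectiveDimensionLT Y n] (i : ℕ) (hi : d < i)
    (M : Type u) [AddCommGroup M] [Module R M] (hM : IsFiniteLength R M) :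
    Subsingleton (Ext (ModuleCat.of R M) Y i) := by
  rcases le_total n i with hn | hn
  · exact HasInjectiveDimensionLT.subsingleton Y n i hn _
  induction hn using Nat.decreasingInduction generalizing M with
  | self => exact HasInjectiveDimensionLT.subsingleton Y n n le_rfl _
  | of_succ i _ ih =>
    -- For a simple `S ⊆ A`, `Ext^i(S, Y)` sits between `Ext^i(A, Y) = 0` and `Ext^{i+1}(A / S, Y)`,
    -- which vanishes by descending induction.
    have hA' := isFiniteLength_iff_isNoetherian_isArtinian.mp hA
    have := hA'.2
    obtain ⟨S, hS⟩ := exists_isSimpleModule_submodule (R := R) A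
    refine subsingleton_ext_of_isFiniteLength (ModuleCat.of R S) Y i ?_ M hM
    have hAi : Subsingleton (Ext A Y i) := HasProjectiveDimensionLT.subsingleton A (d + 1) i hi Y
    have key (α : Ext (ModuleCat.of R S) Y i) : α = 0 := by
      obtain ⟨β, rfl⟩ := exists_ext_extension (M := ModuleCat.of R S) (N := A) S.subtype
        S.subtype_injective i (ih (hi.trans (Nat.lt_succ_self i)) _
          (hA.of_surjective (Submodule.mkQ_surjective _))) α
      rw [Subsingleton.elim β 0, Ext.comp_zero]
    exact ⟨fun a b => (key a).trans (key b).symm⟩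

end Homological

/-! ### The double annihilator condition modulo a maximal regular sequence. -/

section DoubleColon

open CategoryTheory CategoryTheory.Abelian RingTheory.Sequence IsLocalRing

universe u

variable {R : Type u} [CommRing R]

/-- Each member of a regular sequence lowers the dimension by one, so the quotient is Noetherian of
dimension zero. -/
theorem isFiniteLength_quotient_of_ringKrullDim [IsLocalRing R] [IsNoetherianRing R]
    (rs : List R) (hreg : IsRegular R rs) (hdim : ringKrullDim R = rs.length) :
    IsFiniteLength R (R ⧸ Ideal.ofList rs) := by
  have h := ringKrullDim_add_length_eq_ringKrullDim_of_isRegular rs hreg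
  have h0 : ringKrullDim (R ⧸ Ideal.ofList rs) ≤ 0 := by
    rw [hdim] at h
    have h1 : ringKrullDim (R ⧸ Ideal.ofList rs) + rs.length ≤ 0 + rs.length := by
      rw [h, zero_add]
    exact (ENat.WithBot.add_le_add_natCast_right_iff).mp h1
  have : Ring.KrullDimLE 0 (R ⧸ Ideal.ofList rs) := Ring.krullDimLE_iff.mpr (by exact_mod_cast h0)
  have : IsArtinianRing (R ⧸ Ideal.ofList rs) :=
    isArtinianRing_iff_krullDimLE_zero.mpr this
  rw [isFiniteLength_iff_isNoetherian_isArtinian]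
  refine ⟨inferInstance, ?_⟩
  exact isArtinian_of_surjective_algebraMap (Ideal.Quotient.mk_surjective (I := Ideal.ofList rs))

/-- Modulo a maximal regular sequence, a ring of finite self-injective dimension satisfies the
double annihilator condition. -/
theorem colon_colon_of_isGorensteinLocalRing [IsGorensteinLocalRing R] (rs : List R)
    (hreg : IsRegular R rs) (hdim : ringKrullDim R = rs.length) (I : Ideal R)
    (hI : Ideal.ofList rs ≤ I) :
    (Ideal.ofList rs).colon ((Ideal.ofList rs).colon (I : Set R) : Set R) = I := by
  set J := Ideal.ofList rs with hJ
  refine le_antisymm (fun x hx => ?_) fun x hx => ?_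
  swap
  · exact Submodule.mem_colon.2 fun a ha => by
      simpa [mul_comm] using Submodule.mem_colon.1 ha x hx
  by_contra hxI
  have hfin := isFiniteLength_quotient_of_ringKrullDim rs hreg hdim
  have hfinI : IsFiniteLength R (R ⧸ I) :=
    hfin.of_surjective (f := Submodule.factor hI) (Submodule.factor_surjective hI)
  have hart := (isFiniteLength_iff_isNoetherian_isArtinian.mp hfin).2
  have hartI := (isFiniteLength_iff_isNoetherian_isArtinian.mp hfinI).2
  have hJtop : J ≠ ⊤ := fun h => hreg.2 (by simpa using h.symm)
  have : Nontrivial (R ⧸ J) := Ideal.Quotient.nontrivial_iff.mpr hJtop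
  -- A simple submodule `T` of the span of `x` in `R / I` embeds in `R / J`, and the embedding
  -- extends to `R / I`. The extension is multiplication by some `a ∈ J : I`; since `x * a ∈ J`, it
  -- kills `T`, a contradiction.
  let X : Submodule R (R ⧸ I) := Submodule.span R {Submodule.Quotient.mk x}
  have : Nontrivial X := by
    rw [Submodule.nontrivial_iff_ne_bot, Ne, Submodule.span_singleton_eq_bot,
      Submodule.Quotient.mk_eq_zero]
    exact hxI
  obtain ⟨T, hT⟩ := exists_isSimpleModule_submodule (R := R) X
  obtain ⟨S, hS⟩ := exists_isSimpleModule_submodule (R := R) (R ⧸ J)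
  obtain ⟨e⟩ := nonempty_linearEquiv_of_isSimpleModule (R := R) T S
  have e' : (R ⧸ J) ≃ₗ[R] R ⧸ (J • ⊤ : Submodule R R) :=
    Submodule.quotEquivOfEq _ _ (by simp)
  obtain ⟨n, hn⟩ := IsGorensteinLocalRing.exists_injectiveDimensionLT (R := R)
  let f : T →ₗ[R] R ⧸ I := X.subtype ∘ₗ T.subtype
  have hf : Function.Injective f := X.subtype_injective.comp T.subtype_injective
  have hpd : HasProjectiveDimensionLT (ModuleCat.of R (R ⧸ J)) (rs.length + 1) := by
    have h := ModuleCat.projectiveDimension_quotient_eq_length rs hreg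
    rw [projectiveDimension_eq_of_iso (Shrink.linearEquiv R (R ⧸ Ideal.ofList rs)).toModuleIso] at h
    exact (projectiveDimension_le_iff _ _).1 h.le
  have hann (N : Type u) [AddCommGroup N] [Module R N] (g : N →ₗ[R] R ⧸ I)
      (hg : Function.Injective g) : ∀ r ∈ rs, r ∈ Module.annihilator R N := by
    intro r hr
    rw [Module.mem_annihilator]
    intro m
    apply hg
    rw [map_smul, map_zero]
    obtain ⟨y, hy⟩ := Submodule.Quotient.mk_surjective I (g m)
    rw [← hy, ← Submodule.Quotient.mk_smul, Submodule.Quotient.mk_eq_zero]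
    exact I.mul_mem_right _ (hI (Ideal.subset_span hr))
  obtain ⟨ψ, hψ⟩ := exists_extension_to_quotient rs (ModuleCat.of R R) hreg.1
    (N := ModuleCat.of R T) (N' := ModuleCat.of R (R ⧸ I)) (ModuleCat.ofHom f)
    (hann T f hf) (hann _ LinearMap.id Function.injective_id)
    (fun α => exists_ext_extension (M := ModuleCat.of R T) (N := ModuleCat.of R (R ⧸ I)) f hf _
      (subsingleton_ext_of_projectiveDimension_of_injectiveDimension (ModuleCat.of R (R ⧸ J))
        (ModuleCat.of R R) hfin rs.length n _ (Nat.lt_succ_self _) _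
        (hfinI.of_surjective (Submodule.mkQ_surjective _))) α)
    (e'.toLinearMap ∘ₗ S.subtype ∘ₗ e.toLinearMap)
  let ψ' : (R ⧸ I) →ₗ[R] R ⧸ J := e'.symm.toLinearMap ∘ₗ ψ
  obtain ⟨a, ha⟩ := Submodule.Quotient.mk_surjective J (ψ' (Submodule.Quotient.mk 1))
  have hψa (r : R) : ψ' (Submodule.Quotient.mk r) = Submodule.Quotient.mk (r * a) := by
    rw [← smul_eq_mul, Submodule.Quotient.mk_smul, ha, ← map_smul, ← Submodule.Quotient.mk_smul,
      smul_eq_mul, mul_one]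
  have haI : a ∈ J.colon (I : Set R) := Submodule.mem_colon.2 fun y hy => by
    rw [← Submodule.Quotient.mk_eq_zero J, smul_eq_mul, mul_comm, ← hψa,
      (Submodule.Quotient.mk_eq_zero I).2 hy, map_zero]
  have hxa : x * a ∈ J := Submodule.mem_colon.1 hx a haI
  have hT0 : Nontrivial T := IsSimpleModule.nontrivial R T
  obtain ⟨t, ht⟩ := exists_ne (0 : T)
  obtain ⟨r, hr⟩ := Submodule.mem_span_singleton.1 (t : X).2
  have h1 : ψ (f t) = e' (S.subtype (e t)) := LinearMap.congr_fun hψ t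
  have h2 : ψ' (f t) = 0 := by
    change ψ' ((t : X) : R ⧸ I) = 0
    rw [← hr, ← Submodule.Quotient.mk_smul, hψa, Submodule.Quotient.mk_eq_zero, smul_eq_mul,
      mul_assoc]
    exact J.mul_mem_left r hxa
  have h3 : S.subtype (e t) = 0 := by
    rw [← h2, ← e'.symm_apply_apply (S.subtype (e t)), ← h1]
    rfl
  exact ht (by simpa using h3)

end DoubleColon

/-! ### Minimal generators over a local ring. -/

section MinimalGenerators

open IsLocalRing

variable {R : Type*} [CommRing R] [IsLocalRing R] {M : Type*} [AddCommGroup M] [Module R M]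

/-- Over a local ring, a finite family generating `N` is minimal if and only if it has `μ(N)`
members. -/
theorem isMinimalGenerators_iff {ι : Type*} [Finite ι] (N : Submodule R M) (x : ι → M) :
    IsMinimalGenerators N x ↔ Submodule.span R (Set.range x) = N ∧ Nat.card ι = N.spanFinrank := by
  have := Fintype.ofFinite ι
  refine ⟨fun ⟨hx, hmin⟩ => ⟨hx, ?_⟩, fun ⟨hx, hcard⟩ => ⟨hx, fun i hi => ?_⟩⟩
  · have hfg : N.FG := hx ▸ Submodule.fg_span (Set.finite_range x)
    have hxN (i : ι) : x i ∈ N := hx ▸ Submodule.subset_span ⟨i, rfl⟩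
    let y : ι → N := fun i => ⟨x i, hxN i⟩
    let V := N ⧸ (maximalIdeal R • (⊤ : Submodule R N))
    let v : ι → V := fun i => Submodule.Quotient.mk (y i)
    let K := R ⧸ maximalIdeal R
    let _ : Field K := Ideal.Quotient.field _
    -- Spans in `N / 𝔪N` over the residue field are spans in `N` up to `𝔪N`, so Nakayama turns a
    -- linear dependence into a redundant generator.
    have hspan (s : Set ι) (z : N) :
        (Submodule.Quotient.mk z : V) ∈ Submodule.span K (v '' s) ↔
          (z : M) ∈ Submodule.span R (x '' s) ⊔ maximalIdeal R • N := by
      have h1 : (Submodule.span K (v '' s)).restrictScalars R = Submodule.span R (v '' s) :=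
        Submodule.restrictScalars_span R K Ideal.Quotient.mk_surjective _
      have h2 : (v '' s) = (maximalIdeal R • (⊤ : Submodule R N)).mkQ '' (y '' s) := by
        rw [Set.image_image]; rfl
      rw [← Submodule.restrictScalars_mem R, h1, h2, ← Submodule.map_span]
      have h3 (P : Submodule R N) : z ∈ P ↔ (z : M) ∈ P.map N.subtype := by simp
      rw [← Submodule.mkQ_apply, ← Submodule.mem_comap, Submodule.comap_map_mkQ, sup_comm, h3,
        Submodule.map_sup, Submodule.map_span, Submodule.map_smul'', Submodule.map_subtype_top,
        Set.image_image]
      rfl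
    have hli : LinearIndependent K v := by
      rw [linearIndependent_iff_notMem_span]
      intro i hi
      rw [← Set.compl_eq_univ_sdiff, hspan] at hi
      refine hmin i (le_antisymm ?_ ?_)
      · rw [Submodule.span_le]
        rintro _ ⟨j, -, rfl⟩
        exact hxN j
      · refine Submodule.le_of_le_smul_of_le_jacobson_bot hfg (maximalIdeal_le_jacobson _) ?_
        conv_lhs => rw [← hx]
        rw [Submodule.span_le]
        rintro _ ⟨j, rfl⟩
        by_cases hj : j = i
        · exact hj ▸ hi
        · exact (le_sup_left : _ ≤ _ ⊔ maximalIdeal R • N) (Submodule.subset_span ⟨j, hj, rfl⟩)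
    have htop : Submodule.span K (Set.range v) = ⊤ := by
      rw [eq_top_iff]
      intro w _
      obtain ⟨z, rfl⟩ := Submodule.Quotient.mk_surjective _ w
      rw [← Set.image_univ, hspan, Set.image_univ, hx]
      exact le_sup_left (a := N) z.2
    rw [spanFinrank_eq_finrank_quotient N hfg, Nat.card_eq_fintype_card]
    exact (Module.finrank_eq_card_basis (Module.Basis.mk hli htop.ge)).symm
  · have h := Submodule.spanFinrank_span_le_ncard_of_finite (R := R)
      ((Set.toFinite {i}ᶜ).image x)
    rw [hi, ← hcard] at h
    have h1 : (x '' {i}ᶜ).ncard ≤ ({i}ᶜ : Set ι).ncard := Set.ncard_image_le (Set.toFinite _)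
    have h2 := Set.ncard_add_ncard_compl ({i} : Set ι)
    rw [Set.ncard_singleton] at h2
    omega

/-- If `𝔪 M = 0` then `μ(M)` is the length of `M`. -/
theorem spanFinrank_top_eq_length_of_isTorsionBySet [Module.Finite R M]
    (h : Module.IsTorsionBySet R M (maximalIdeal R : Set R)) :
    ((⊤ : Submodule R M).spanFinrank : ℕ∞) = Module.length R M := by
  let K := R ⧸ maximalIdeal R
  let _ : Field K := Ideal.Quotient.field _
  let _ : Module K M := h.module
  have : IsScalarTower R K M := h.isScalarTower
  have : Module.Finite K M := Module.Finite.of_restrictScalars_finite R K M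
  rw [Module.length_eq_of_surjective (S := R) (R := K) Ideal.Quotient.mk_surjective,
    Module.length_eq_finrank]
  have b := Module.finBasis K M
  have hb : IsMinimalGenerators (⊤ : Submodule R M) b := by
    refine ⟨?_, fun i hi => ?_⟩
    · rw [← Submodule.restrictScalars_span R K Ideal.Quotient.mk_surjective, b.span_eq]
      rfl
    · refine linearIndependent_iff_notMem_span.1 b.linearIndependent i ?_
      rw [← Set.compl_eq_univ_sdiff, ← Submodule.restrictScalars_mem R,
        Submodule.restrictScalars_span R K Ideal.Quotient.mk_surjective, hi]
      trivial
  have := ((isMinimalGenerators_iff _ _).1 hb).2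
  rw [← this, Nat.card_eq_fintype_card, Fintype.card_fin]

theorem rank_eq_of_length_eq {n : ℕ}
    (h : Module.IsTorsionBySet R M (maximalIdeal R : Set R)) (hn : Module.length R M = n) :
    letI := h.module
    Module.rank (R ⧸ maximalIdeal R) M = n := by
  let K := R ⧸ maximalIdeal R
  let _ : Field K := Ideal.Quotient.field _
  let _ : Module K M := h.module
  have : IsScalarTower R K M := h.isScalarTower
  rw [Module.length_eq_of_surjective (S := R) (R := K) Ideal.Quotient.mk_surjective,
    Module.length_eq_rank] at hn
  exact Cardinal.toENat_eq_natCast.mp hn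

end MinimalGenerators

/-! ### Lengths of quotients as Krull dimensions of intervals of ideals. -/

section Interval

open IsLocalRing

variable {R : Type*} [CommRing R]

/-- The submodules of `I / L` correspond to the ideals between `L` and `I`. -/
noncomputable def submoduleIdealQuotientOrderIso (I L : Ideal R) (h : L ≤ I) :
    Submodule R (idealQuotient I L) ≃o Set.Icc L I where
  toFun Q := ⟨(Q.comap (Submodule.submoduleOf L I).mkQ).map I.subtype, by
    intro x hx
    refine ⟨⟨x, h hx⟩, ?_, rfl⟩
    have h0 : (Submodule.submoduleOf L I).mkQ ⟨x, h hx⟩ = 0 :=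
      (Submodule.Quotient.mk_eq_zero _).2 hx
    exact (congrArg (· ∈ Q) h0).mpr Q.zero_mem, Submodule.map_subtype_le _ _⟩
  invFun K := (Submodule.submoduleOf K.1 I).map (Submodule.submoduleOf L I).mkQ
  left_inv Q := by
    simp only [Submodule.submoduleOf]
    rw [Submodule.comap_map_eq_of_injective I.subtype_injective]
    exact Submodule.map_comap_eq_of_surjective (Submodule.mkQ_surjective _) Q
  right_inv K := by
    have hLK : Submodule.submoduleOf L I ≤ Submodule.submoduleOf K.1 I :=
      Submodule.comap_mono K.2.1
    apply Subtype.ext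
    simp only [Submodule.comap_map_mkQ, sup_eq_right.2 hLK]
    simp only [Submodule.submoduleOf, Submodule.map_comap_subtype]
    exact inf_eq_right.2 K.2.2
  map_rel_iff' {P Q} := by
    change Submodule.map _ _ ≤ Submodule.map _ _ ↔ _
    rw [Submodule.map_le_map_iff_of_injective I.subtype_injective,
      Submodule.comap_le_comap_iff_of_surjective (Submodule.mkQ_surjective _)]

/-- Length depends only on the order of the interval, so an order-reversing bijection of intervals
preserves it. -/
theorem length_idealQuotient (I L : Ideal R) (h : L ≤ I) :
    (Module.length R (idealQuotient I L) : WithBot ℕ∞) = Order.krullDim (Set.Icc L I) := by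
  rw [Module.coe_length, Order.krullDim_eq_of_orderIso (submoduleIdealQuotientOrderIso I L h)]

/-- If every ideal `I ⊇ J` satisfies `J : (J : I) = I`, then `(J : L) / (J : I)` and `I / L` have
the same length. -/
theorem length_colon_idealQuotient {J : Ideal R}
    (hJ : ∀ I : Ideal R, J ≤ I → J.colon (J.colon (I : Set R) : Set R) = I)
    (I L : Ideal R) (hL : J ≤ L) (h : L ≤ I) :
    Module.length R (idealQuotient (J.colon (L : Set R)) (J.colon (I : Set R))) =
      Module.length R (idealQuotient I L) := by
  have hanti {A B : Ideal R} (hAB : A ≤ B) : J.colon (B : Set R) ≤ J.colon (A : Set R) :=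
    Submodule.colon_mono le_rfl hAB
  apply WithBot.coe_injective
  rw [length_idealQuotient _ _ (hanti h), length_idealQuotient _ _ h,
    ← Order.krullDim_orderDual (α := Set.Icc L I)]
  refine Order.krullDim_eq_of_orderIso
    { toFun K := OrderDual.toDual ⟨J.colon (K : Set R), ?_, ?_⟩
      invFun K := ⟨J.colon ((OrderDual.ofDual K).1 : Set R), hanti (OrderDual.ofDual K).2.2,
        hanti (OrderDual.ofDual K).2.1⟩
      left_inv K := Subtype.ext (hJ _ (Ideal.le_colon.trans K.2.1))
      right_inv K := OrderDual.ofDual.injective (Subtype.ext (hJ _ (hL.trans (OrderDual.ofDual K).2.1)))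
      map_rel_iff' {A B} := ?_ }
  · exact (hJ L hL).ge.trans (hanti K.2.2)
  · exact (hanti K.2.1).trans (hJ I (hL.trans h)).le
  · refine ⟨fun h => ?_, fun h => hanti h⟩
    have h' : J.colon ((B : Ideal R) : Set R) ≤ J.colon ((A : Ideal R) : Set R) := h
    have := hanti h'
    rwa [hJ _ (Ideal.le_colon.trans A.2.1), hJ _ (Ideal.le_colon.trans B.2.1)] at this

end Interval

/-! ### Generators of `I / L` in terms of ideals. -/

section IdealQuotientGenerators

open IsLocalRing

variable {R : Type*} [CommRing R]

theorem span_idealQuotientMk_eq_top_iff {I L : Ideal R} (h : L ≤ I) {ι : Type*} (b : ι → I)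
    (s : Set ι) :
    Submodule.span R ((fun i => idealQuotientMk I L (b i)) '' s) = ⊤ ↔
      L ⊔ Ideal.span ((fun i => (b i : R)) '' s) = I := by
  have h1 : (fun i => idealQuotientMk I L (b i)) '' s =
      (Submodule.submoduleOf L I).mkQ '' (b '' s) := by
    rw [Set.image_image]; rfl
  rw [h1, ← Submodule.map_span, Submodule.map_mkQ_eq_top,
    ← (Submodule.map_injective_of_injective I.subtype_injective).eq_iff, Submodule.map_sup,
    Submodule.map_span, Submodule.map_subtype_top, Submodule.submoduleOf,
    Submodule.map_comap_subtype, inf_eq_right.2 h, Set.image_image]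
  rfl

theorem isMinimalGenerators_idealQuotientMk_iff {I L : Ideal R} (h : L ≤ I) {ι : Type*}
    (b : ι → I) :
    IsMinimalGenerators (R := R) ⊤ (fun i => idealQuotientMk I L (b i)) ↔
      L ⊔ Ideal.span (Set.range fun i => (b i : R)) = I ∧
        ∀ i, L ⊔ Ideal.span ((fun i => (b i : R)) '' {i}ᶜ) ≠ I := by
  simp only [IsMinimalGenerators, ← Set.image_univ, span_idealQuotientMk_eq_top_iff h, ne_eq]

theorem exists_isMinimalGenerators_idealQuotientMk [IsLocalRing R] [IsNoetherianRing R]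
    {I L : Ideal R} {n : ℕ} (hn : (⊤ : Submodule R (idealQuotient I L)).spanFinrank = n) :
    ∃ b : Fin n → I, IsMinimalGenerators (R := R) ⊤ fun i => idealQuotientMk I L (b i) := by
  obtain ⟨t, ht, hspan⟩ := (IsNoetherian.noetherian
    (⊤ : Submodule R (idealQuotient I L))).exists_span_finset_card_eq_spanFinrank
  let e := (t.equivFinOfCardEq (ht.trans hn)).symm
  choose b hb using fun i => Submodule.Quotient.mk_surjective (Submodule.submoduleOf L I) (e i).1
  refine ⟨b, (isMinimalGenerators_iff _ _).2 ⟨?_, by simp [hn]⟩⟩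
  have h1 : (Set.range fun i => idealQuotientMk I L (b i)) = t := by
    ext q
    constructor
    · rintro ⟨i, rfl⟩
      simp only [idealQuotientMk, hb]
      exact (e i).2
    · intro hq
      exact ⟨e.symm ⟨q, hq⟩, by simp only [idealQuotientMk, hb, Equiv.apply_symm_apply]⟩
  rw [h1, hspan]

/-- Let the ideal `I` contain `J = (z)`. Then `z` extends to a minimal system of generators of `I`
if and only if `μ(I)` is the number of members of `z` plus `μ(I / J)`. -/
theorem exists_isMinimalGenerators_sumElim_iff [IsLocalRing R] [IsNoetherianRing R] {I : Ideal R}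
    {d n : ℕ} (z : Fin d → R) (hJ : Ideal.span (Set.range z) ≤ I) (b : Fin n → I)
    (hb : IsMinimalGenerators (R := R) ⊤
      fun i => idealQuotientMk I (Ideal.span (Set.range z)) (b i)) :
    (∃ (r : ℕ) (c : Fin r → R), IsMinimalGenerators I (Sum.elim z c)) ↔
      I.spanFinrank = d + n := by
  constructor
  · rintro ⟨r, c, hc⟩
    have hcard := ((isMinimalGenerators_iff _ _).1 hc).2
    have hcI (i : Fin r) : c i ∈ I :=
      hc.1 ▸ Submodule.subset_span ⟨Sum.inr i, rfl⟩
    -- A member of `c` redundant modulo `(z)` would be redundant in `(z, c)`; hence `r = μ(I / J) =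
    -- n`.
    have hc' : IsMinimalGenerators (R := R) ⊤ fun i =>
        idealQuotientMk I (Ideal.span (Set.range z)) (⟨c i, hcI i⟩ : I) := by
      rw [isMinimalGenerators_idealQuotientMk_iff hJ]
      refine ⟨?_, fun i hi => hc.2 (Sum.inr i) (Eq.trans ?_ hi)⟩
      · conv_rhs => rw [← hc.1, Set.Sum.elim_range]
        exact (Submodule.span_union _ _).symm
      · have : Sum.elim z c '' {Sum.inr i}ᶜ = Set.range z ∪ c '' {i}ᶜ := by
          ext x
          simp
        rw [this]
        exact Submodule.span_union _ _
    have h1 := ((isMinimalGenerators_iff _ _).1 hc').2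
    have h2 := ((isMinimalGenerators_iff _ _).1 hb).2
    simp only [Nat.card_eq_fintype_card, Fintype.card_sum, Fintype.card_fin] at hcard h1 h2
    rw [← hcard, h1, h2]
  · intro h
    refine ⟨n, fun i => b i, (isMinimalGenerators_iff _ _).2 ⟨?_, by simp [h]⟩⟩
    rw [Set.Sum.elim_range]
    refine (Submodule.span_union _ _).trans ?_
    exact ((isMinimalGenerators_idealQuotientMk_iff hJ b).1 hb).1

end IdealQuotientGenerators

/-! ### Colon ideals and iterated links. -/

section Links

open IsLocalRing

variable {R : Type*} [CommRing R]

/-- Both sides say `x K I ⊆ J`; the summand `J` changes nothing and makes the ideal eligible for the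
double colon. -/
theorem colon_mul_sup_eq (I J K : Ideal R) :
    J.colon ((K * I ⊔ J : Ideal R) : Set R) = (J.colon (I : Set R)).colon (K : Set R) := by
  ext x
  rw [Submodule.mem_colon, Submodule.mem_colon]
  constructor
  · intro h a ha
    refine Submodule.mem_colon.2 fun y hy => ?_
    rw [smul_eq_mul, smul_eq_mul, mul_assoc]
    exact h _ (Ideal.mem_sup_left (Ideal.mul_mem_mul ha hy))
  · intro h y hy
    have h1 : K * I ⊔ J ≤ J.colon ({x} : Set R) := by
      refine sup_le (Ideal.mul_le.2 fun a ha y hy => ?_) Ideal.le_colon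
      rw [Submodule.mem_colon_singleton]
      have := Submodule.mem_colon.1 (h a ha) y hy
      simp only [smul_eq_mul] at this ⊢
      rwa [mul_comm, ← mul_assoc]
    have h2 := Submodule.mem_colon_singleton.1 (h1 hy)
    rw [smul_eq_mul] at h2 ⊢
    rwa [mul_comm]

theorem isFiniteLength_idealQuotient {J I L : Ideal R} (hJL : J ≤ L)
    (hJ : IsFiniteLength R (R ⧸ J)) : IsFiniteLength R (idealQuotient I L) := by
  refine (hJ.of_surjective (f := Submodule.factor hJL) (Submodule.factor_surjective hJL)).of_injective
    (f := Submodule.mapQ (Submodule.submoduleOf L I) L I.subtype le_rfl) ?_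
  refine (injective_iff_map_eq_zero _).2 fun q hq => ?_
  obtain ⟨x, rfl⟩ := Submodule.Quotient.mk_surjective _ q
  exact (Submodule.Quotient.mk_eq_zero _).2 ((Submodule.Quotient.mk_eq_zero L).1 hq)

variable [IsLocalRing R]

/-- Otherwise the colon is the whole ring, so `𝔪 = 𝔪²` and Nakayama gives `𝔪 = 0`. This supplies `k
= 2`, where nothing is assumed on `𝔪^k : 𝔪`. -/
theorem maximalIdeal_sq_colon [IsNoetherianRing R] (h : maximalIdeal R ≠ ⊥) :
    (maximalIdeal R ^ 2).colon (maximalIdeal R : Set R) = maximalIdeal R := by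
  refine le_antisymm (le_maximalIdeal fun htop => h ?_) fun x hx => ?_
  · rw [Submodule.colon_eq_top_iff_subset] at htop
    refine Submodule.eq_bot_of_le_smul_of_le_jacobson_bot (maximalIdeal R) (maximalIdeal R)
      (IsNoetherian.noetherian _) ?_ (maximalIdeal_le_jacobson _)
    rw [smul_eq_mul, ← sq]
    exact htop
  · refine Submodule.mem_colon.2 fun y hy => ?_
    rw [smul_eq_mul, sq]
    exact Ideal.mul_mem_mul hx hy

theorem isTorsionBySet_idealQuotient_iteratedLink (J : Ideal R) {k : ℕ} (hk : 1 ≤ k) :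
    Module.IsTorsionBySet R (idealQuotient (iteratedLink J k) (iteratedLink J (k - 1)))
      (maximalIdeal R : Set R) := by
  intro q a
  obtain ⟨x, rfl⟩ := Submodule.Quotient.mk_surjective _ q
  rw [← Submodule.Quotient.mk_smul, Submodule.Quotient.mk_eq_zero]
  refine Submodule.mem_colon.2 fun y hy => ?_
  have h1 : (a : R) * y ∈ maximalIdeal R ^ k := by
    rw [← Nat.sub_add_cancel hk, pow_succ']
    exact Ideal.mul_mem_mul a.2 hy
  have h2 := Submodule.mem_colon.1 x.2 _ h1
  simpa [mul_assoc, mul_comm, mul_left_comm] using h2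

end Links

/-! ### The structure of the iterated links. -/

theorem mainTheorem5 {R : Type*} [CommRing R] [IsGorensteinLocalRing R]
    (d : ℕ) (hdim : ringKrullDim R = d) (hd : 2 ≤ d)
    (s : ℕ) (hs : 2 ≤ s)
    (z : Fin d → R) (hreg : RingTheory.Sequence.IsRegular R (List.ofFn z))
    (hz : ∀ i, z i ∈ IsLocalRing.maximalIdeal R ^ s)
    (J : Ideal R) (hJ : J = Ideal.span (Set.range z))
    (hcolon : ∀ k, 3 ≤ k → k ≤ s →
      (IsLocalRing.maximalIdeal R ^ k).colon (IsLocalRing.maximalIdeal R : Set R) =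
        IsLocalRing.maximalIdeal R ^ (k - 1))
    (k : ℕ) (hk : 1 ≤ k) (hks : k ≤ s) :
    ∃ n : ℕ,
      Module.length R (idealQuotient (IsLocalRing.maximalIdeal R ^ (k - 1))
        (IsLocalRing.maximalIdeal R ^ k)) = n ∧
      iteratedLink J (k - 1) ≤ iteratedLink J k ∧
      (∃ h : Module.IsTorsionBySet R (idealQuotient (iteratedLink J k) (iteratedLink J (k - 1)))
          (IsLocalRing.maximalIdeal R : Set R),
        letI := h.module
        Module.rank (R ⧸ IsLocalRing.maximalIdeal R)
          (idealQuotient (iteratedLink J k) (iteratedLink J (k - 1))) = n) ∧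
      (∃ b : Fin n → iteratedLink J k,
        iteratedLink J k = iteratedLink J (k - 1) ⊔ Ideal.span (Set.range fun i => (b i : R)) ∧
        IsMinimalGenerators (R := R) ⊤
          fun i => idealQuotientMk (iteratedLink J k) (iteratedLink J (k - 1)) (b i)) ∧
      J ≤ iteratedLink J k ∧
      (∀ b : Fin n → iteratedLink J k,
        (iteratedLink J k = iteratedLink J (k - 1) ⊔ Ideal.span (Set.range fun i => (b i : R)) ∧
          IsMinimalGenerators (R := R) ⊤
            fun i => idealQuotientMk (iteratedLink J k) (iteratedLink J (k - 1)) (b i)) →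
        iteratedLink J k = J ⊔ Ideal.span (Set.range fun i => (b i : R)) ∧
          IsMinimalGenerators (R := R) ⊤ fun i => idealQuotientMk (iteratedLink J k) J (b i)) ∧
      ((∃ (r : ℕ) (c : Fin r → R), IsMinimalGenerators (iteratedLink J k) (Sum.elim z c)) ↔
        (iteratedLink J k).spanFinrank = d + n) ∧
      iteratedLink J (k - 1) = IsLocalRing.maximalIdeal R * iteratedLink J k ⊔ J := by
  set m := IsLocalRing.maximalIdeal R with hm
  have hofList : Ideal.ofList (List.ofFn z) = J := by
    rw [hJ]
    exact congrArg Ideal.span (Set.ext fun x => List.mem_ofFn)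
  have hdim' : ringKrullDim R = (List.ofFn z).length := by simpa using hdim
  have hfin := isFiniteLength_quotient_of_ringKrullDim _ hreg hdim'
  have hcc (I : Ideal R) (hI : J ≤ I) : J.colon (J.colon (I : Set R) : Set R) = I := by
    have h := colon_colon_of_isGorensteinLocalRing _ hreg hdim' I (hofList.trans_le hI)
    rwa [hofList] at h
  rw [hofList] at hfin
  have hJs : J ≤ m ^ s := by
    rw [hJ, Ideal.span_le]
    rintro _ ⟨i, rfl⟩
    exact hz i
  have hJk : J ≤ m ^ k := hJs.trans (Ideal.pow_le_pow_right hks)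
  have hpow : m ^ k ≤ m ^ (k - 1) := Ideal.pow_le_pow_right (Nat.sub_le k 1)
  have hm0 : m ≠ ⊥ := fun h => by
    have h0 := ringKrullDim_eq_zero_of_isField (IsLocalRing.isField_iff_maximalIdeal_eq.2 h)
    rw [hdim] at h0
    have : d = 0 := by exact_mod_cast h0
    omega
  have hmk : (m ^ k).colon (m : Set R) = m ^ (k - 1) := by
    obtain rfl | rfl | h3 : k = 1 ∨ k = 2 ∨ 3 ≤ k := by omega
    · simp
    · simpa using maximalIdeal_sq_colon hm0
    · exact hcolon k h3 hks
  have hle : iteratedLink J (k - 1) ≤ iteratedLink J k := Submodule.colon_mono le_rfl hpow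
  have hJle : J ≤ iteratedLink J k := Ideal.le_colon
  have hJle' : J ≤ iteratedLink J (k - 1) := Ideal.le_colon
  have hlink : iteratedLink J (k - 1) = m * iteratedLink J k ⊔ J := by
    rw [← hcc (m * iteratedLink J k ⊔ J) le_sup_right, colon_mul_sup_eq, iteratedLink,
      iteratedLink, hcc _ hJk, hmk]
  obtain ⟨n, hn⟩ := ENat.ne_top_iff_exists.1
    (Module.length_ne_top_iff.2 (isFiniteLength_idealQuotient (I := m ^ (k - 1)) hJk hfin))
  have hlen : Module.length R (idealQuotient (iteratedLink J k) (iteratedLink J (k - 1))) = n :=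
    (length_colon_idealQuotient hcc _ _ hJk hpow).trans hn.symm
  have htor := isTorsionBySet_idealQuotient_iteratedLink J hk
  have hmin (b : Fin n → iteratedLink J k)
      (hb : IsMinimalGenerators (R := R) ⊤
        fun i => idealQuotientMk (iteratedLink J k) (iteratedLink J (k - 1)) (b i)) :
      J ⊔ Ideal.span (Set.range fun i => (b i : R)) = iteratedLink J k ∧
        IsMinimalGenerators (R := R) ⊤ fun i => idealQuotientMk (iteratedLink J k) J (b i) := by
    rw [isMinimalGenerators_idealQuotientMk_iff hle] at hb
    rw [isMinimalGenerators_idealQuotientMk_iff hJle]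
    have hspan (t : Set (Fin n)) : Ideal.span ((fun i => (b i : R)) '' t) ≤ iteratedLink J k := by
      rw [Ideal.span_le]
      rintro _ ⟨i, -, rfl⟩
      exact (b i).2
    have hgen : J ⊔ Ideal.span (Set.range fun i => (b i : R)) = iteratedLink J k := by
      refine le_antisymm (sup_le hJle ?_) ?_
      · simpa using hspan Set.univ
      -- Nakayama, since `I_k = I_{k-1} + (b) = 𝔪 I_k + J + (b)` by (d).
      · refine Submodule.le_of_le_smul_of_le_jacobson_bot (IsNoetherian.noetherian _)
          (IsLocalRing.maximalIdeal_le_jacobson _) ?_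
        conv_lhs => rw [← hb.1, hlink]
        rw [smul_eq_mul, sup_assoc, sup_comm]
    -- A subfamily generating modulo `J` also generates modulo the larger `I_{k-1}`.
    refine ⟨hgen, hgen, fun i hi => hb.2 i (le_antisymm (sup_le hle (hspan _)) ?_)⟩
    conv_lhs => rw [← hi]
    exact sup_le_sup_right hJle' _
  obtain ⟨b₀, hb₀⟩ := exists_isMinimalGenerators_idealQuotientMk (n := n) (by
    exact_mod_cast (spanFinrank_top_eq_length_of_isTorsionBySet htor).trans hlen)
  refine ⟨n, hn.symm, hle, ⟨htor, rank_eq_of_length_eq htor hlen⟩, ⟨b₀, ?_, hb₀⟩, hJle,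
    fun b hb => ⟨(hmin b hb.2).1.symm, (hmin b hb.2).2⟩, ?_, hlink⟩
  · exact ((isMinimalGenerators_idealQuotientMk_iff hle b₀).1 hb₀).1.symm
  · subst hJ
    exact exists_isMinimalGenerators_sumElim_iff z hJle b₀ (hmin b₀ hb₀).2
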